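/- Let $X$ and $Y$ be random vectors in $\mathbb{R}^d$ with finite second moments, with covariance matrices $\Sigma(X)$ and $\Sigma(Y)$. Let $N_X$ and $N_Y$ be their normal approximations, that is, the (possibly degenerate) Gaussian measures on $\mathbb{R}^d$ with the same means and covariance matrices as $X$ and $Y$. Let $W_2$ be the $2$-Wasserstein distance of laws, $$W_2(\mu,\nu)^2=\inf_{\gamma}\int\|x-y\|^2\,d\gamma(x,y),$$ where $\|\cdot\|$ is the Euclidean norm and the infimum is over all measures $\gamma$ on $\mathbb{R}^d\times\mathbb{R}^d$ with marginals $\mu$ and $\nu$. Then $$\bigl|W_2(N_X,N_Y)-W_2(X,Y)\bigr|\;\le\;\frac{2\,\mathrm{Tr}\bigl[(\Sigma(X)\Sigma(Y))^{1/2}\bigr]}{\sqrt{\mathrm{Tr}[\Sigma(X)]+\mathrm{Tr}[\Sigma(Y)]}} .$$ Here $(\Sigma(X)\Sigma(Y))^{1/2}$ is the principal square root, that is, the unique real matrix $R$ with $R^2=\Sigma(X)\Sigma(Y)$ that is diagonalizable over $\mathbb{R}$ with nonnegative eigenvalues. If $\Sigma(X)=\Sigma(Y)=0$, the right-hand side is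 read as $0$. -/

import Mathlib

open MeasureTheory ProbabilityTheory
open scoped ENNReal

noncomputable section

namespace AffineTransport

/-! ### The 2-Wasserstein distance -/

section Wasserstein

variable {E : Type*} [NormedAddCommGroup E] [MeasurableSpace E]

/-- The admissible plans between `μ` and `ν`: measures on the product space with first marginal
`μ` and second marginal `ν`. -/
def couplings (μ ν : Measure E) : Set (Measure (E × E)) :=
  {γ | γ.map Prod.fst = μ ∧ γ.map Prod.snd = ν}

/-- The optimal transport cost between `μ` and `ν` for the squared distance, with values in
`[0, ∞]`. -/
def transportCost (μ ν : Measure E) : ℝ≥0∞ :=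
  ⨅ γ ∈ couplings μ ν, ∫⁻ z, ‖z.1 - z.2‖ₑ ^ 2 ∂γ

/-- The 2-Wasserstein distance: the square root of the optimal cost for the squared distance.
The cost is finite for measures with finite second moments, see `transportCost_lt_top`. -/
def W2 (μ ν : Measure E) : ℝ :=
  Real.sqrt (transportCost μ ν).toReal

/-- The optimal cost between two probability measures with finite second moments is finite. -/
theorem transportCost_lt_top [BorelSpace E] [SecondCountableTopology E] {μ ν : Measure E}
    [IsProbabilityMeasure μ] [IsProbabilityMeasure ν] (hμ : MemLp id 2 μ) (hν : MemLp id 2 ν) :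
    transportCost μ ν < ∞ := by
  have hmem : μ.prod ν ∈ couplings μ ν := by
    constructor
    · simp [Measure.map_fst_prod]
    · simp [Measure.map_snd_prod]
  refine lt_of_le_of_lt (iInf₂_le (μ.prod ν) hmem) ?_
  have h1 : MemLp (fun z : E × E => z.1) 2 (μ.prod ν) := hμ.comp_fst ν
  have h2 : MemLp (fun z : E × E => z.2) 2 (μ.prod ν) := hν.comp_snd μ
  have h := (h1.sub h2).eLpNorm_lt_top
  have h3 := lintegral_rpow_enorm_lt_top_of_eLpNorm_lt_top (p := 2) (by simp) (by simp) h
  simpa using h3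

end Wasserstein

/-! ### Mean, covariance matrix and normal approximation -/

section NormalApproximation

variable {d : ℕ}

/-- The covariance matrix of a measure on `ℝ^d`. -/
def covMatrix (μ : Measure (EuclideanSpace ℝ (Fin d))) : Matrix (Fin d) (Fin d) ℝ :=
  Matrix.of fun i j => cov[fun x => x i, fun x => x j; μ]

/-- The normal approximation of a measure on `ℝ^d`: the (possibly degenerate) Gaussian measure
with the same mean and the same covariance matrix. -/
def normalApprox (μ : Measure (EuclideanSpace ℝ (Fin d))) :
    Measure (EuclideanSpace ℝ (Fin d)) :=
  multivariateGaussian (∫ x, x ∂μ) (covMatrix μ)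

theorem covMatrix_eq_covarianceBilin {μ : Measure (EuclideanSpace ℝ (Fin d))}
    [IsProbabilityMeasure μ] (hμ : MemLp id 2 μ) (i j : Fin d) :
    covMatrix μ i j = covarianceBilin μ (EuclideanSpace.basisFun (Fin d) ℝ i)
      (EuclideanSpace.basisFun (Fin d) ℝ j) := by
  rw [covarianceBilin_apply_eq_cov hμ]
  simp only [covMatrix, Matrix.of_apply, EuclideanSpace.basisFun_inner]

theorem posSemidef_covMatrix {μ : Measure (EuclideanSpace ℝ (Fin d))} [IsProbabilityMeasure μ]
    (hμ : MemLp id 2 μ) : (covMatrix μ).PosSemidef := by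
  refine Matrix.PosSemidef.of_dotProduct_mulVec_nonneg ?_ ?_
  · ext i j
    simp [covMatrix, covariance_comm]
  · intro x
    have h := covarianceBilin_self_nonneg (μ := μ)
      (∑ i, x i • EuclideanSpace.basisFun (Fin d) ℝ i)
    simp only [map_sum, map_smul, sum_apply,
      smul_apply, ← covMatrix_eq_covarianceBilin hμ, smul_eq_mul] at h
    simp only [dotProduct, Matrix.mulVec, Pi.star_apply, star_trivial]
    refine h.trans_eq ?_
    simp only [Finset.mul_sum]
    rw [Finset.sum_comm]
    refine Finset.sum_congr rfl fun i _ => Finset.sum_congr rfl fun j _ => ?_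
    ring

theorem isGaussian_normalApprox (μ : Measure (EuclideanSpace ℝ (Fin d))) :
    IsGaussian (normalApprox μ) :=
  isGaussian_multivariateGaussian

theorem integral_normalApprox (μ : Measure (EuclideanSpace ℝ (Fin d))) :
    ∫ x, x ∂(normalApprox μ) = ∫ x, x ∂μ :=
  integral_id_multivariateGaussian

theorem covMatrix_normalApprox {μ : Measure (EuclideanSpace ℝ (Fin d))} [IsProbabilityMeasure μ]
    (hμ : MemLp id 2 μ) : covMatrix (normalApprox μ) = covMatrix μ := by
  ext i j
  exact covariance_eval_multivariateGaussian (posSemidef_covMatrix hμ) i j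

end NormalApproximation

/-! ### The principal square root of a matrix -/

section Sqrt

open Matrix

variable {n : Type*} [Fintype n] [DecidableEq n]

/-- `R` is the principal square root of the real matrix `M`: `R ^ 2 = M`, and `R` is
diagonalizable over `ℝ` with nonnegative eigenvalues. Neither matrix needs to be symmetric. -/
def IsPrincipalSqrt (M R : Matrix n n ℝ) : Prop :=
  R * R = M ∧ ∃ (P : Matrix n n ℝ) (t : n → ℝ),
    IsUnit P.det ∧ (∀ i, 0 ≤ t i) ∧ R = P * diagonal t * P⁻¹

/-- The principal square root of `M`. It is unique if it exists, see `IsPrincipalSqrt.unique`, and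
it exists for the product of two positive semidefinite matrices, see
`isPrincipalSqrt_principalSqrt_mul`. The value is `0` if there is none. -/
def principalSqrt (M : Matrix n n ℝ) : Matrix n n ℝ :=
  open Classical in if h : ∃ R, IsPrincipalSqrt M R then h.choose else 0

theorem IsPrincipalSqrt.unique {M R R' : Matrix n n ℝ} (h : IsPrincipalSqrt M R)
    (h' : IsPrincipalSqrt M R') : R = R' := by
  obtain ⟨hR, P, t, hP, ht, rfl⟩ := h
  obtain ⟨hR', P', t', hP', ht', rfl⟩ := h'
  have e1 : P⁻¹ * P = 1 := nonsing_inv_mul P hP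
  have e2 : P * P⁻¹ = 1 := mul_nonsing_inv P hP
  have e3 : P'⁻¹ * P' = 1 := nonsing_inv_mul P' hP'
  have e4 : P' * P'⁻¹ = 1 := mul_nonsing_inv P' hP'
  have key : P * (diagonal t * diagonal t) * P⁻¹ = P' * (diagonal t' * diagonal t') * P'⁻¹ := by
    calc P * (diagonal t * diagonal t) * P⁻¹
        = P * diagonal t * (P⁻¹ * P) * diagonal t * P⁻¹ := by rw [e1]; noncomm_ring
      _ = M := by rw [← hR]; noncomm_ring
      _ = P' * diagonal t' * (P'⁻¹ * P') * diagonal t' * P'⁻¹ := by rw [← hR']; noncomm_ring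
      _ = _ := by rw [e3]; noncomm_ring
  have key2 : (P'⁻¹ * P) * (diagonal t * diagonal t)
      = (diagonal t' * diagonal t') * (P'⁻¹ * P) := by
    calc (P'⁻¹ * P) * (diagonal t * diagonal t)
        = P'⁻¹ * (P * (diagonal t * diagonal t) * P⁻¹) * P := by
          rw [show P'⁻¹ * (P * (diagonal t * diagonal t) * P⁻¹) * P
            = P'⁻¹ * P * (diagonal t * diagonal t) * (P⁻¹ * P) by noncomm_ring, e1, mul_one]
      _ = (P'⁻¹ * P') * (diagonal t' * diagonal t') * (P'⁻¹ * P) := by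
          rw [key]; noncomm_ring
      _ = _ := by rw [e3, one_mul]
  have key3 : (P'⁻¹ * P) * diagonal t = diagonal t' * (P'⁻¹ * P) := by
    ext i j
    have h := congrFun (congrFun key2 i) j
    simp only [diagonal_mul_diagonal, mul_diagonal, diagonal_mul] at h ⊢
    by_cases hq : (P'⁻¹ * P) i j = 0
    · simp [hq]
    · have h2 : t j * t j = t' i * t' i := by
        apply mul_left_cancel₀ hq
        rw [h]; ring
      have h3 : t j = t' i := by
        have := ht j
        have := ht' i
        nlinarith [sq_nonneg (t j - t' i), mul_self_inj_of_nonneg (ht j) (ht' i) |>.1 h2]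
      rw [h3]; ring
  calc P * diagonal t * P⁻¹ = (P' * P'⁻¹) * P * diagonal t * P⁻¹ := by rw [e4, one_mul]
    _ = P' * ((P'⁻¹ * P) * diagonal t) * P⁻¹ := by noncomm_ring
    _ = P' * diagonal t' * P'⁻¹ * (P * P⁻¹) := by rw [key3]; noncomm_ring
    _ = _ := by rw [e2, mul_one]

theorem IsPrincipalSqrt.principalSqrt_eq {M R : Matrix n n ℝ} (h : IsPrincipalSqrt M R) :
    principalSqrt M = R := by
  have hex : ∃ R, IsPrincipalSqrt M R := ⟨R, h⟩
  rw [principalSqrt, dif_pos hex]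
  exact hex.choose_spec.unique h

/-- If the eigenvectors of `M` with nonnegative eigenvalues span, then `M` has a principal square
root. -/
theorem exists_isPrincipalSqrt_of_span {M : Matrix n n ℝ}
    (h : ⊤ ≤ Submodule.span ℝ {v : n → ℝ | ∃ s : ℝ, 0 ≤ s ∧ M *ᵥ v = s • v}) :
    ∃ R, IsPrincipalSqrt M R := by
  let b₀ := Module.Basis.ofSpan h
  have hb₀ : ∀ i, ∃ s : ℝ, 0 ≤ s ∧ M *ᵥ (b₀ i) = s • b₀ i := fun i =>
    Module.Basis.ofSpan_subset h (Set.mem_range_self i)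
  let e := b₀.indexEquiv (Pi.basisFun ℝ n)
  let b : Module.Basis n ℝ (n → ℝ) := b₀.reindex e
  have hb : ∀ i, ∃ s : ℝ, 0 ≤ s ∧ M *ᵥ (b i) = s • b i := fun i => by
    simpa [b] using hb₀ (e.symm i)
  choose s hs hM using hb
  let P : Matrix n n ℝ := Matrix.of fun i j => b j i
  have hP : IsUnit P.det := by
    have : P = (Pi.basisFun ℝ n).toMatrix b := by
      ext i j; simp [P, Module.Basis.toMatrix_apply]
    rw [this]
    exact (Pi.basisFun ℝ n).isUnit_det b
  have hMP : M * P = P * diagonal s := by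
    ext i j
    have := congrFun (hM j) i
    rw [mul_diagonal]
    simpa [P, Matrix.mul_apply, mulVec, dotProduct, mul_comm] using this
  refine ⟨P * diagonal (fun i => √(s i)) * P⁻¹, ?_, P, fun i => √(s i), hP,
    fun i => Real.sqrt_nonneg _, rfl⟩
  have e1 : P⁻¹ * P = 1 := nonsing_inv_mul P hP
  have e2 : P * P⁻¹ = 1 := mul_nonsing_inv P hP
  have hd : diagonal (fun i => √(s i)) * diagonal (fun i => √(s i)) = diagonal s := by
    rw [diagonal_mul_diagonal]
    congr 1
    ext i
    exact Real.mul_self_sqrt (hs i)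
  calc P * diagonal (fun i => √(s i)) * P⁻¹ * (P * diagonal (fun i => √(s i)) * P⁻¹)
      = P * diagonal (fun i => √(s i)) * (P⁻¹ * P) * diagonal (fun i => √(s i)) * P⁻¹ := by
        noncomm_ring
    _ = P * (diagonal (fun i => √(s i)) * diagonal (fun i => √(s i))) * P⁻¹ := by
        rw [e1]; noncomm_ring
    _ = M * (P * P⁻¹) := by rw [hd, ← hMP, mul_assoc]
    _ = M := by rw [e2, mul_one]

open scoped MatrixOrder in
theorem exists_isPrincipalSqrt_mul {A B : Matrix n n ℝ} (hA : A.PosSemidef)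
    (hB : B.PosSemidef) : ∃ R, IsPrincipalSqrt (A * B) R := by
  apply exists_isPrincipalSqrt_of_span
  let S := CFC.sqrt A
  have hSS : S * S = A := CFC.sqrt_mul_sqrt_self A hA.nonneg
  have hSp : S.PosSemidef := (CFC.sqrt_nonneg A).posSemidef
  have hSt : Sᵀ = S := by simpa using hSp.isHermitian.eq
  have hBt : Bᵀ = B := by simpa using hB.isHermitian.eq
  have hC : (S * B * S).PosSemidef := by
    have := hB.mul_mul_conjTranspose_same S
    rwa [hSp.isHermitian.eq] at this
  let c : n → n → ℝ := fun i => ⇑(hC.isHermitian.eigenvectorBasis i)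
  let l : n → ℝ := hC.isHermitian.eigenvalues
  have hc : ∀ i, (S * B * S) *ᵥ c i = l i • c i := fun i =>
    hC.isHermitian.mulVec_eigenvectorBasis i
  have hl : ∀ i, 0 ≤ l i := hC.eigenvalues_nonneg
  have hrep : ∀ x : n → ℝ, x = ∑ i, (c i ⬝ᵥ x) • c i := by
    intro x
    have h := hC.isHermitian.eigenvectorBasis.sum_repr' (WithLp.toLp 2 x)
    have h2 := congrArg WithLp.ofLp h
    simp only [WithLp.ofLp_sum, WithLp.ofLp_smul] at h2
    rw [← h2]
    refine Finset.sum_congr rfl fun i _ => ?_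
    congr 1
    rw [h2, EuclideanSpace.inner_eq_star_dotProduct]
    simp [c, dotProduct_comm]
  have hT : ∀ i, (A * B) *ᵥ (S *ᵥ c i) = l i • (S *ᵥ c i) := by
    intro i
    rw [← mulVec_smul, ← hc i, mulVec_mulVec, mulVec_mulVec, ← hSS]
    congr 1
    noncomm_ring
  have hzero : ∀ i, l i = 0 → B *ᵥ (S *ᵥ c i) = 0 := by
    intro i hi
    apply (hB.dotProduct_mulVec_zero_iff _).1
    have h := hc i
    rw [hi, zero_smul] at h
    have h2 : c i ⬝ᵥ (S * B * S) *ᵥ c i = 0 := by rw [h]; simp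
    rw [← mulVec_mulVec, ← mulVec_mulVec, dotProduct_mulVec, ← mulVec_transpose, hSt] at h2
    simpa using h2
  intro x _
  set V := Submodule.span ℝ {v : n → ℝ | ∃ s : ℝ, 0 ≤ s ∧ (A * B) *ᵥ v = s • v} with hV
  let y : n → ℝ := ∑ i, ((c i ⬝ᵥ (S * B) *ᵥ x) / l i) • (S *ᵥ c i)
  have hy : y ∈ V := Submodule.sum_mem _ fun i _ =>
    Submodule.smul_mem _ _ (Submodule.subset_span ⟨l i, hl i, hT i⟩)
  have hxy : (A * B) *ᵥ (x - y) = (0 : ℝ) • (x - y) := by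
    rw [zero_smul, mulVec_sub, sub_eq_zero]
    calc (A * B) *ᵥ x = S *ᵥ ((S * B) *ᵥ x) := by rw [mulVec_mulVec, ← hSS, mul_assoc]
      _ = S *ᵥ ∑ i, (c i ⬝ᵥ (S * B) *ᵥ x) • c i := by rw [← hrep]
      _ = ∑ i, (c i ⬝ᵥ (S * B) *ᵥ x) • (S *ᵥ c i) := by
        rw [mulVec_sum]; simp only [mulVec_smul]
      _ = (A * B) *ᵥ y := by
        simp only [y, mulVec_sum, mulVec_smul, hT]
        refine Finset.sum_congr rfl fun i _ => ?_
        by_cases hi : l i = 0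
        · have : c i ⬝ᵥ (S * B) *ᵥ x = 0 := by
            rw [dotProduct_mulVec, ← mulVec_transpose, transpose_mul, hSt, hBt, ← mulVec_mulVec,
              hzero i hi, zero_dotProduct]
          simp [this]
        · rw [smul_smul, div_mul_cancel₀ _ hi]
  have hz : x - y ∈ V := Submodule.subset_span ⟨0, le_rfl, hxy⟩
  simpa using V.add_mem hz hy

/-- The product of two positive semidefinite matrices has a principal square root. -/
theorem isPrincipalSqrt_principalSqrt_mul {A B : Matrix n n ℝ} (hA : A.PosSemidef)
    (hB : B.PosSemidef) : IsPrincipalSqrt (A * B) (principalSqrt (A * B)) := by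
  obtain ⟨R, hR⟩ := exists_isPrincipalSqrt_mul hA hB
  rwa [hR.principalSqrt_eq]

end Sqrt

end AffineTransport

end

/-! Write `a` for the squared distance of the means, `T = Tr A + Tr B` for the covariance matrices
`A`, `B`, and `K` for the trace of the principal square root of `A * B`. Every plan costs `a + T - 2
Tr C`, where `C` is its cross-covariance matrix. The independent plan has `C = 0`, and `Tr C ≤ K`
for every plan (`trace_le_trace_principalSqrt_mul`), so `W2` lies between `√(a + T - 2K)` and `√(a +
T)` (`le_W2`, `W2_le`).

These bounds depend only on means and covariances, so they hold equally for the normal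
approximations. The two distances therefore lie in one interval, whose length is at most `2K / √T`
(`sqrt_add_sub_sqrt_le`). The exact formula for the distance of Gaussians is not needed. -/

namespace AffineTransport

/-! ### Bounding the trace of a cross-covariance matrix -/

section TraceInequality

open Matrix

variable {n : Type*} [Fintype n] {A B C : Matrix n n ℝ}

/-- The Cauchy-Schwarz inequality for a cross-covariance matrix. -/
theorem dotProduct_mulVec_le_sqrt_mul_sqrt (hA : A.PosSemidef)
    (h : ∀ p q : n → ℝ, 2 * (p ⬝ᵥ C *ᵥ q) ≤ p ⬝ᵥ A *ᵥ p + q ⬝ᵥ B *ᵥ q) (p q : n → ℝ) :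
    p ⬝ᵥ C *ᵥ q ≤ √(p ⬝ᵥ A *ᵥ p) * √(q ⬝ᵥ B *ᵥ q) := by
  have ha : 0 ≤ p ⬝ᵥ A *ᵥ p := by simpa using hA.dotProduct_mulVec_nonneg p
  rw [← Real.sqrt_mul ha]
  apply Real.le_sqrt_of_sq_le
  -- Replacing `p` by `t • p` in `h` gives a quadratic in `t` that is nonnegative everywhere.
  have hdisc : discrim (p ⬝ᵥ A *ᵥ p) (-(2 * (p ⬝ᵥ C *ᵥ q))) (q ⬝ᵥ B *ᵥ q) ≤ 0 := by
    refine discrim_le_zero fun t => ?_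
    have := h (t • p) q
    simp only [mulVec_smul, smul_dotProduct, dotProduct_smul, smul_eq_mul] at this
    linarith
  rw [discrim] at hdisc
  linarith

/-- Each diagonal entry pairs a row of `P` with a column of `Q` through `C`, so Cauchy-Schwarz
applies entrywise. The freedom in `P` and `Q` allows the bound to be used in a well-chosen basis. -/
theorem trace_mul_mul_le_sum_sqrt_mul_sqrt (hA : A.PosSemidef)
    (h : ∀ p q : n → ℝ, 2 * (p ⬝ᵥ C *ᵥ q) ≤ p ⬝ᵥ A *ᵥ p + q ⬝ᵥ B *ᵥ q)
    (P Q : Matrix n n ℝ) :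
    (P * C * Q).trace ≤ ∑ i, √((P * A * Pᵀ) i i) * √((Qᵀ * B * Q) i i) := by
  have key : ∀ (M P Q : Matrix n n ℝ) (i : n), (P * M * Q) i i = P i ⬝ᵥ M *ᵥ Qᵀ i := by
    intro M P Q i
    rw [mul_assoc, mul_apply]
    rfl
  refine Finset.sum_le_sum fun i _ => ?_
  rw [diag_apply, key, key, key]
  exact dotProduct_mulVec_le_sqrt_mul_sqrt hA h _ _

variable [DecidableEq n]

/-- Since `R` is similar to `diagonal t`, its square `M` is similar to the diagonal matrix of the `t
i ^ 2`. Thus the spectrum of `M` determines the trace of `R`. -/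
theorem IsPrincipalSqrt.exists_trace_eq {M R : Matrix n n ℝ} (h : IsPrincipalSqrt M R) :
    ∃ t : n → ℝ, (∀ i, 0 ≤ t i) ∧ R.trace = ∑ i, t i ∧
      M.charpoly.roots = Finset.univ.val.map fun i => t i ^ 2 := by
  obtain ⟨rfl, P, t, hP, ht, rfl⟩ := h
  have e1 : P⁻¹ * P = 1 := nonsing_inv_mul P hP
  refine ⟨t, ht, ?_, ?_⟩
  · rw [trace_mul_comm, ← mul_assoc, e1, one_mul, trace_diagonal]
  · have hM : P * diagonal t * P⁻¹ * (P * diagonal t * P⁻¹)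
        = P * (diagonal fun i => t i ^ 2) * P⁻¹ := by
      calc P * diagonal t * P⁻¹ * (P * diagonal t * P⁻¹)
          = P * diagonal t * (P⁻¹ * P) * diagonal t * P⁻¹ := by noncomm_ring
        _ = P * (diagonal t * diagonal t) * P⁻¹ := by rw [e1]; noncomm_ring
        _ = _ := by simp only [diagonal_mul_diagonal, pow_two]
    rw [hM, charpoly_mul_comm, ← mul_assoc, e1, one_mul, charpoly_diagonal,
      Polynomial.roots_prod _ _
        (Finset.prod_ne_zero_iff.2 fun i _ => Polynomial.X_sub_C_ne_zero _)]
    simp only [Polynomial.roots_X_sub_C, Multiset.bind_singleton]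

/-- The trace of the principal square root of `F * Fᵀ * B` is the sum of the square roots of the
eigenvalues of the symmetric matrix `Fᵀ * B * F`. -/
theorem trace_principalSqrt_mul_transpose_mul {F B : Matrix n n ℝ} (hB : B.PosSemidef)
    (hD : (Fᵀ * B * F).PosSemidef) :
    (principalSqrt (F * Fᵀ * B)).trace = ∑ i, √(hD.isHermitian.eigenvalues i) := by
  have hA : (F * Fᵀ).PosSemidef := by
    simpa using posSemidef_self_mul_conjTranspose F
  obtain ⟨t, ht, htr, hroots⟩ := (isPrincipalSqrt_principalSqrt_mul hA hB).exists_trace_eq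
  -- Moving `F` to the right end of the product keeps the characteristic polynomial and turns `F *
  -- Fᵀ * B` into the symmetric `Fᵀ * B * F`.
  rw [mul_assoc, charpoly_mul_comm, hD.isHermitian.roots_charpoly_eq_eigenvalues] at hroots
  have h := congrArg (fun s : Multiset ℝ => (s.map Real.sqrt).sum) hroots
  simp only [Multiset.map_map] at h
  rw [htr]
  calc ∑ i, t i = ∑ i, √(t i ^ 2) :=
        Finset.sum_congr rfl fun i _ => (Real.sqrt_sq (ht i)).symm
    _ = _ := h.symm

/-- An orthogonal diagonalization of a real positive semidefinite matrix. -/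
theorem _root_.Matrix.PosSemidef.exists_orthogonal_diagonalization {A : Matrix n n ℝ}
    (hA : A.PosSemidef) : ∃ U : Matrix n n ℝ, Uᵀ * U = 1 ∧ U * Uᵀ = 1 ∧
      A = U * diagonal hA.isHermitian.eigenvalues * Uᵀ := by
  refine ⟨hA.isHermitian.eigenvectorUnitary, ?_, ?_, ?_⟩
  · have := Unitary.coe_star_mul_self hA.isHermitian.eigenvectorUnitary
    simpa [star_eq_conjTranspose] using this
  · have := Unitary.coe_mul_star_self hA.isHermitian.eigenvectorUnitary
    simpa [star_eq_conjTranspose] using this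
  · have := hA.isHermitian.spectral_theorem
    rw [Unitary.conjStarAlgAut_apply] at this
    simpa [star_eq_conjTranspose, Function.comp_def] using this

/-- If `C` is the cross-covariance matrix of two random vectors with covariance matrices `A` and
`B`, then the trace of `C` is at most that of the principal square root of `A * B`. -/
theorem trace_le_trace_principalSqrt_mul (hA : A.PosSemidef) (hB : B.PosSemidef)
    (h : ∀ p q : n → ℝ, 2 * (p ⬝ᵥ C *ᵥ q) ≤ p ⬝ᵥ A *ᵥ p + q ⬝ᵥ B *ᵥ q) :
    C.trace ≤ (principalSqrt (A * B)).trace := by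
  obtain ⟨U, hU, hU', hAU⟩ := hA.exists_orthogonal_diagonalization
  set a := hA.isHermitian.eigenvalues
  have ha : ∀ i, 0 ≤ a i := hA.eigenvalues_nonneg
  let F : Matrix n n ℝ := U * diagonal fun i => √(a i)
  -- `G` is the pseudo-inverse of `F`: as `0⁻¹ = 0`, `χ` is the indicator of the nonzero eigenvalues
  -- of `A`, and `F * G` is the orthogonal projection onto the range of `A`.
  let G : Matrix n n ℝ := (diagonal fun i => (√(a i))⁻¹) * Uᵀ
  let χ : n → ℝ := fun i => √(a i) * (√(a i))⁻¹
  have hχ : ∀ i, χ i ≤ 1 := fun i => mul_inv_le_one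
  have hFF : F * Fᵀ = A := by
    simp only [F, transpose_mul, diagonal_transpose]
    rw [hAU, mul_assoc, ← mul_assoc (diagonal _) (diagonal _), diagonal_mul_diagonal, mul_assoc]
    simp only [Real.mul_self_sqrt (ha _)]
  have hGF : G * F = diagonal χ := by
    calc G * F = (diagonal fun i => (√(a i))⁻¹) * (Uᵀ * U) * diagonal fun i => √(a i) := by
          simp only [G, F]; noncomm_ring
      _ = _ := by
          rw [hU, mul_one, diagonal_mul_diagonal]
          simp only [χ, mul_comm]
  have hEF : (1 - F * G) * F = 0 := by
    rw [sub_mul, one_mul, mul_assoc, hGF, sub_eq_zero]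
    simp only [F, mul_assoc, diagonal_mul_diagonal]
    congr 2
    ext i
    by_cases hi : √(a i) = 0
    · simp [hi]
    · simp [χ, hi]
  -- The part of `C` off the range of `A` contributes nothing positive to the trace: Cauchy-Schwarz
  -- bounds it through `(1 - F * G) * A * (1 - F * G)ᵀ`, which is zero by `hEF`.
  have hE : ((1 - F * G) * C * 1).trace ≤ 0 := by
    refine (trace_mul_mul_le_sum_sqrt_mul_sqrt hA h _ _).trans_eq ?_
    rw [← hFF, ← mul_assoc, hEF]
    simp
  have hD : (Fᵀ * B * F).PosSemidef := by
    simpa using hB.conjTranspose_mul_mul_same F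
  obtain ⟨W, hW, hW', hDW⟩ := hD.exists_orthogonal_diagonalization
  -- The trace is rewritten in the eigenbasis `W` of `Fᵀ * B * F`. With `P = Wᵀ * G` and `Q = F *
  -- W`, the `A`-factors in Cauchy-Schwarz are at most 1 and the `B`-factors are the square roots of
  -- the eigenvalues, whose sum is the trace of the principal square root.
  have h1 : ((Wᵀ * G) * C * (F * W)).trace = (F * G * C).trace := by
    calc ((Wᵀ * G) * C * (F * W)).trace = (Wᵀ * (G * C * F * W)).trace := by
          congr 1; noncomm_ring
      _ = (F * (G * C)).trace := by
          rw [trace_mul_comm, mul_assoc, hW', mul_one, trace_mul_comm]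
      _ = _ := by rw [mul_assoc F G C]
  have h2 : (Wᵀ * G) * A * (Wᵀ * G)ᵀ = Wᵀ * diagonal (fun i => χ i * χ i) * W := by
    calc (Wᵀ * G) * A * (Wᵀ * G)ᵀ = Wᵀ * ((G * F) * (G * F)ᵀ) * W := by
          rw [← hFF]; simp only [transpose_mul, transpose_transpose]; noncomm_ring
      _ = _ := by rw [hGF, diagonal_transpose, diagonal_mul_diagonal]
  have h3 : (F * W)ᵀ * B * (F * W) = diagonal hD.isHermitian.eigenvalues := by
    calc (F * W)ᵀ * B * (F * W) = Wᵀ * (Fᵀ * B * F) * W := by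
          simp only [transpose_mul]; noncomm_ring
      _ = (Wᵀ * W) * diagonal hD.isHermitian.eigenvalues * (Wᵀ * W) := by
          conv_lhs => rw [hDW]
          noncomm_ring
      _ = _ := by rw [hW, one_mul, mul_one]
  -- The columns of `W` are unit vectors, and the weights `χ k * χ k` are at most 1.
  have h4 : ∀ i, (Wᵀ * diagonal (fun i => χ i * χ i) * W) i i ≤ 1 := by
    intro i
    have hχ0 : ∀ k, 0 ≤ χ k := fun k => by positivity
    have hone := congrFun (congrFun hW i) i
    rw [mul_apply, one_apply_eq] at hone
    rw [mul_apply, ← hone]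
    refine Finset.sum_le_sum fun k _ => ?_
    rw [mul_diagonal, transpose_apply]
    nlinarith [mul_le_one₀ (hχ k) (hχ0 k) (hχ k), mul_self_nonneg (W k i)]
  have h5 : (F * G * C).trace ≤ (principalSqrt (A * B)).trace := by
    rw [← h1]
    refine (trace_mul_mul_le_sum_sqrt_mul_sqrt hA h _ _).trans ?_
    rw [← hFF, trace_principalSqrt_mul_transpose_mul hB hD, hFF, h2, h3]
    refine Finset.sum_le_sum fun i _ => ?_
    rw [diagonal_apply_eq]
    exact mul_le_of_le_one_left (Real.sqrt_nonneg _) (Real.sqrt_le_one.2 (h4 i))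
  have h6 : C.trace = ((1 - F * G) * C * 1).trace + (F * G * C).trace := by
    rw [← trace_add]; congr 1; noncomm_ring
  linarith

end TraceInequality

/-! ### Two-sided bounds on the transport cost by means and covariances -/

section Gelbrich

variable {d : ℕ} {μ ν : Measure (EuclideanSpace ℝ (Fin d))}
  {γ : Measure (EuclideanSpace ℝ (Fin d) × EuclideanSpace ℝ (Fin d))}

theorem isProbabilityMeasure_of_mem_couplings [IsProbabilityMeasure μ]
    (hγ : γ ∈ couplings μ ν) : IsProbabilityMeasure γ := by
  constructor
  rw [← Set.preimage_univ (f := Prod.fst),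
    ← Measure.map_apply measurable_fst MeasurableSet.univ, hγ.1, measure_univ]

theorem memLp_fst_of_mem_couplings (hμ : MemLp id 2 μ) (hγ : γ ∈ couplings μ ν) :
    MemLp Prod.fst 2 γ := by
  rw [← hγ.1] at hμ
  exact (memLp_map_measure_iff hμ.1 measurable_fst.aemeasurable).1 hμ

theorem memLp_snd_of_mem_couplings (hν : MemLp id 2 ν) (hγ : γ ∈ couplings μ ν) :
    MemLp Prod.snd 2 γ := by
  rw [← hγ.2] at hν
  exact (memLp_map_measure_iff hν.1 measurable_snd.aemeasurable).1 hν

theorem memLp_eval {Ω : Type*} [MeasurableSpace Ω] {P : Measure Ω}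
    {X : Ω → EuclideanSpace ℝ (Fin d)} (hX : MemLp X 2 P) (i : Fin d) :
    MemLp (fun ω => X ω i) 2 P :=
  (EuclideanSpace.proj (𝕜 := ℝ) i).comp_memLp' hX

/-- The matrix of the covariances between the coordinates of the two marginals. -/
noncomputable def crossCov (γ : Measure (EuclideanSpace ℝ (Fin d) × EuclideanSpace ℝ (Fin d))) :
    Matrix (Fin d) (Fin d) ℝ :=
  Matrix.of fun i j => cov[fun z => z.1 i, fun z => z.2 j; γ]

theorem covMatrix_fst_of_mem_couplings (hγ : γ ∈ couplings μ ν) (i j : Fin d) :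
    covMatrix μ i j = cov[fun z => z.1 i, fun z => z.1 j; γ] := by
  rw [← hγ.1, covMatrix, Matrix.of_apply, covariance_map_fun]
  all_goals fun_prop

theorem covMatrix_snd_of_mem_couplings (hγ : γ ∈ couplings μ ν) (i j : Fin d) :
    covMatrix ν i j = cov[fun z => z.2 i, fun z => z.2 j; γ] := by
  rw [← hγ.2, covMatrix, Matrix.of_apply, covariance_map_fun]
  all_goals fun_prop

theorem covariance_sum_mul_sum_mul {Ω : Type*} [MeasurableSpace Ω] {P : Measure Ω}
    [IsFiniteMeasure P] {f g : Fin d → Ω → ℝ} (hf : ∀ i, MemLp (f i) 2 P)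
    (hg : ∀ i, MemLp (g i) 2 P) (p q : Fin d → ℝ) :
    cov[fun ω => ∑ i, p i * f i ω, fun ω => ∑ j, q j * g j ω; P]
      = p ⬝ᵥ (Matrix.of fun i j => cov[f i, g j; P]).mulVec q := by
  rw [covariance_fun_sum_fun_sum (fun i => (hf i).const_mul (p i))
    (fun j => (hg j).const_mul (q j))]
  simp only [covariance_const_mul_left, covariance_const_mul_right, dotProduct, Matrix.mulVec,
    Matrix.of_apply, Finset.mul_sum]
  refine Finset.sum_congr rfl fun i _ => Finset.sum_congr rfl fun j _ => ?_
  ring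

/-- Under the plan, the variance of `p ⬝ᵥ x - q ⬝ᵥ y` is nonnegative; expanding it by bilinearity
gives the claim. -/
theorem two_mul_dotProduct_crossCov_le [IsProbabilityMeasure μ] (hμ : MemLp id 2 μ)
    (hν : MemLp id 2 ν) (hγ : γ ∈ couplings μ ν) (p q : Fin d → ℝ) :
    2 * (p ⬝ᵥ (crossCov γ).mulVec q)
      ≤ p ⬝ᵥ (covMatrix μ).mulVec p + q ⬝ᵥ (covMatrix ν).mulVec q := by
  have := isProbabilityMeasure_of_mem_couplings hγ
  have hf := memLp_eval (memLp_fst_of_mem_couplings hμ hγ)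
  have hg := memLp_eval (memLp_snd_of_mem_couplings hν hγ)
  have hμγ : covMatrix μ = Matrix.of fun i j => cov[fun z => z.1 i, fun z => z.1 j; γ] := by
    ext i j; exact covMatrix_fst_of_mem_couplings hγ i j
  have hνγ : covMatrix ν = Matrix.of fun i j => cov[fun z => z.2 i, fun z => z.2 j; γ] := by
    ext i j; exact covMatrix_snd_of_mem_couplings hγ i j
  have hF : MemLp (fun z => ∑ i, p i * z.1 i) 2 γ :=
    memLp_finsetSum _ fun i _ => (hf i).const_mul (p i)
  have hG : MemLp (fun z => ∑ i, q i * z.2 i) 2 γ :=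
    memLp_finsetSum _ fun i _ => (hg i).const_mul (q i)
  rw [hμγ, hνγ, crossCov, ← covariance_sum_mul_sum_mul hf hf, ← covariance_sum_mul_sum_mul hg hg,
    ← covariance_sum_mul_sum_mul hf hg, covariance_self hF.aemeasurable,
    covariance_self hG.aemeasurable]
  have h := variance_nonneg
    ((fun z => ∑ i, p i * z.1 i) - fun z => ∑ i, q i * z.2 i) γ
  rw [variance_sub hF hG] at h
  linarith

/-- The cost of a plan in terms of the means and the covariances. -/
theorem lintegral_enorm_sub_sq_of_mem_couplings [IsProbabilityMeasure μ] (hμ : MemLp id 2 μ)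
    (hν : MemLp id 2 ν) (hγ : γ ∈ couplings μ ν) :
    ∫⁻ z, ‖z.1 - z.2‖ₑ ^ 2 ∂γ = ENNReal.ofReal (‖∫ x, x ∂μ - ∫ x, x ∂ν‖ ^ 2
      + (covMatrix μ).trace + (covMatrix ν).trace - 2 * (crossCov γ).trace) := by
  have := isProbabilityMeasure_of_mem_couplings hγ
  have hfst := memLp_fst_of_mem_couplings hμ hγ
  have hsnd := memLp_snd_of_mem_couplings hν hγ
  have hf := memLp_eval hfst
  have hg := memLp_eval hsnd
  have hsub : MemLp (fun z : EuclideanSpace ℝ (Fin d) × EuclideanSpace ℝ (Fin d) =>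
      z.1 - z.2) 2 γ := hfst.sub hsnd
  have hmean : ∫ x, x ∂μ - ∫ x, x ∂ν = ∫ z, (z.1 - z.2) ∂γ := by
    have h1 : ∫ x, x ∂μ = ∫ z, z.1 ∂γ := by
      rw [← hγ.1]
      exact integral_map measurable_fst.aemeasurable aestronglyMeasurable_id
    have h2 : ∫ x, x ∂ν = ∫ z, z.2 ∂γ := by
      rw [← hγ.2]
      exact integral_map measurable_snd.aemeasurable aestronglyMeasurable_id
    rw [h1, h2]
    exact (integral_sub (hfst.integrable (by norm_num)) (hsnd.integrable (by norm_num))).symm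
  have hcoord : ∀ i, ∫ z, (z.1 i - z.2 i) ^ 2 ∂γ = (∫ x, x ∂μ - ∫ x, x ∂ν) i ^ 2
      + covMatrix μ i i + covMatrix ν i i - 2 * crossCov γ i i := by
    intro i
    -- The variance of the coordinate difference is computed twice: as second moment minus squared
    -- mean, and from the covariances.
    have hv := variance_eq_sub ((hf i).sub (hg i))
    rw [variance_sub (hf i) (hg i), ← covariance_self (hf i).aemeasurable,
      ← covariance_self (hg i).aemeasurable, ← covMatrix_fst_of_mem_couplings hγ,
      ← covMatrix_snd_of_mem_couplings hγ] at hv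
    have hm : (∫ x, x ∂μ - ∫ x, x ∂ν) i = ∫ z, (z.1 i - z.2 i) ∂γ := by
      rw [hmean]
      exact ((EuclideanSpace.proj (𝕜 := ℝ) i).integral_comp_comm
        (hsub.integrable (by norm_num))).symm
    simp only [Pi.pow_apply, Pi.sub_apply, ← hm] at hv
    simp only [crossCov, Matrix.of_apply]
    linarith
  have hint : ∫ z, ‖z.1 - z.2‖ ^ 2 ∂γ = ‖∫ x, x ∂μ - ∫ x, x ∂ν‖ ^ 2
      + (covMatrix μ).trace + (covMatrix ν).trace - 2 * (crossCov γ).trace := by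
    simp only [EuclideanSpace.real_norm_sq_eq, PiLp.sub_apply, Matrix.trace, Matrix.diag_apply]
    refine (integral_finsetSum _ fun i _ => ((hf i).sub (hg i)).integrable_sq).trans ?_
    simp only [Pi.sub_apply, hcoord, PiLp.sub_apply, Finset.sum_add_distrib, Finset.sum_sub_distrib,
      Finset.mul_sum]
  rw [← hint, ofReal_integral_eq_lintegral_ofReal hsub.integrable_norm_pow'
    (ae_of_all _ fun z => by positivity)]
  refine lintegral_congr fun z => ?_
  rw [ENNReal.ofReal_pow (norm_nonneg _), ofReal_norm]

/-- The independent coupling bounds the transport cost. -/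
theorem transportCost_le [IsProbabilityMeasure μ] [IsProbabilityMeasure ν] (hμ : MemLp id 2 μ)
    (hν : MemLp id 2 ν) :
    transportCost μ ν ≤ ENNReal.ofReal (‖∫ x, x ∂μ - ∫ x, x ∂ν‖ ^ 2
      + (covMatrix μ).trace + (covMatrix ν).trace) := by
  have hmem : μ.prod ν ∈ couplings μ ν := by
    constructor
    · simp [Measure.map_fst_prod]
    · simp [Measure.map_snd_prod]
  have hcross : crossCov (μ.prod ν) = 0 := by
    ext i j
    exact covariance_fst_snd_prod (memLp_eval hμ i) (memLp_eval hν j)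
  refine (iInf₂_le _ hmem).trans_eq ?_
  rw [lintegral_enorm_sub_sq_of_mem_couplings hμ hν hmem, hcross]
  simp

/-- **Gelbrich's lower bound** for the transport cost. -/
theorem le_transportCost [IsProbabilityMeasure μ] [IsProbabilityMeasure ν] (hμ : MemLp id 2 μ)
    (hν : MemLp id 2 ν) :
    ENNReal.ofReal (‖∫ x, x ∂μ - ∫ x, x ∂ν‖ ^ 2 + (covMatrix μ).trace + (covMatrix ν).trace
      - 2 * (principalSqrt (covMatrix μ * covMatrix ν)).trace) ≤ transportCost μ ν := by
  refine le_iInf₂ fun γ hγ => ?_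
  rw [lintegral_enorm_sub_sq_of_mem_couplings hμ hν hγ]
  apply ENNReal.ofReal_le_ofReal
  have := trace_le_trace_principalSqrt_mul (posSemidef_covMatrix hμ) (posSemidef_covMatrix hν)
    (two_mul_dotProduct_crossCov_le hμ hν hγ)
  linarith

theorem W2_le [IsProbabilityMeasure μ] [IsProbabilityMeasure ν] (hμ : MemLp id 2 μ)
    (hν : MemLp id 2 ν) :
    W2 μ ν ≤ √(‖∫ x, x ∂μ - ∫ x, x ∂ν‖ ^ 2 + (covMatrix μ).trace + (covMatrix ν).trace) := by
  have hA := (posSemidef_covMatrix hμ).trace_nonneg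
  have hB := (posSemidef_covMatrix hν).trace_nonneg
  exact Real.sqrt_le_sqrt (ENNReal.toReal_le_of_le_ofReal (by positivity) (transportCost_le hμ hν))

/-- Finiteness of the cost makes `toReal` faithful here. If the expression under the root is
negative, `Real.sqrt` gives 0 and the bound is trivial. -/
theorem le_W2 [IsProbabilityMeasure μ] [IsProbabilityMeasure ν] (hμ : MemLp id 2 μ)
    (hν : MemLp id 2 ν) :
    √(‖∫ x, x ∂μ - ∫ x, x ∂ν‖ ^ 2 + (covMatrix μ).trace + (covMatrix ν).trace
      - 2 * (principalSqrt (covMatrix μ * covMatrix ν)).trace) ≤ W2 μ ν :=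
  Real.sqrt_le_sqrt ((ENNReal.ofReal_le_iff_le_toReal (transportCost_lt_top hμ hν).ne).1
    (le_transportCost hμ hν))

end Gelbrich

/-! ### The length of the interval and the conclusion -/

theorem trace_principalSqrt_mul_nonneg {n : Type*} [Fintype n] [DecidableEq n]
    {A B : Matrix n n ℝ} (hA : A.PosSemidef) (hB : B.PosSemidef) :
    0 ≤ (principalSqrt (A * B)).trace := by
  obtain ⟨t, ht, htr, -⟩ := (isPrincipalSqrt_principalSqrt_mul hA hB).exists_trace_eq
  rw [htr]
  exact Finset.sum_nonneg fun i _ => ht i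

/-- This covers the degenerate case, where the denominator of the final bound vanishes. -/
theorem trace_principalSqrt_mul_eq_zero {n : Type*} [Fintype n] [DecidableEq n]
    {A B : Matrix n n ℝ} (hA : A.PosSemidef) (hB : B.PosSemidef) (h : A.trace + B.trace = 0) :
    (principalSqrt (A * B)).trace = 0 := by
  have hA0 : A = 0 := hA.trace_eq_zero_iff.1 (by linarith [hA.trace_nonneg, hB.trace_nonneg])
  have h0 : IsPrincipalSqrt (0 : Matrix n n ℝ) 0 := ⟨by simp, 1, 0, by simp, by simp, by simp⟩
  rw [hA0, zero_mul, h0.principalSqrt_eq, Matrix.trace_zero]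

/-- With `s` and `r` the two roots, `(s - r) * √T ≤ (s - r) * (s + r) ≤ 2 * K`, because `√T ≤ s`.
When `T = 0`, both sides are 0. -/
theorem sqrt_add_sub_sqrt_le {a T K : ℝ} (ha : 0 ≤ a) (hT : 0 ≤ T) (hK : 0 ≤ K)
    (hTK : T = 0 → K = 0) : √(a + T) - √(a + T - 2 * K) ≤ 2 * K / √T := by
  rcases hT.eq_or_lt with rfl | hT
  · simp [hTK rfl]
  · have h1 : √(a + T) * √(a + T) = a + T := Real.mul_self_sqrt (by linarith)
    -- Only an inequality, since the radicand may be negative; it is the direction needed.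
    have h2 : a + T - 2 * K ≤ √(a + T - 2 * K) * √(a + T - 2 * K) := by
      rw [← pow_two]
      rcases le_total 0 (a + T - 2 * K) with h | h
      · exact (Real.sq_sqrt h).ge
      · exact h.trans (sq_nonneg _)
    have h3 : √T ≤ √(a + T) := Real.sqrt_le_sqrt (by linarith)
    have h4 : √(a + T - 2 * K) ≤ √(a + T) := Real.sqrt_le_sqrt (by linarith)
    rw [le_div_iff₀ (Real.sqrt_pos.2 hT)]
    nlinarith [Real.sqrt_nonneg (a + T - 2 * K)]

end AffineTransport

theorem mainTheorem2 {d : ℕ}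
    {Ω : Type*} [MeasurableSpace Ω] (P : Measure Ω) [IsProbabilityMeasure P]
    {Ω' : Type*} [MeasurableSpace Ω'] (P' : Measure Ω') [IsProbabilityMeasure P']
    (X : Ω → EuclideanSpace ℝ (Fin d)) (Y : Ω' → EuclideanSpace ℝ (Fin d))
    (hX : MemLp X 2 P) (hY : MemLp Y 2 P') :
    |AffineTransport.W2 (AffineTransport.normalApprox (P.map X))
          (AffineTransport.normalApprox (P'.map Y))
        - AffineTransport.W2 (P.map X) (P'.map Y)|
      ≤ 2 * (AffineTransport.principalSqrt
            (AffineTransport.covMatrix (P.map X) * AffineTransport.covMatrix (P'.map Y))).trace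
        / √((AffineTransport.covMatrix (P.map X)).trace
            + (AffineTransport.covMatrix (P'.map Y)).trace) := by
  have := Measure.isProbabilityMeasure_map hX.aestronglyMeasurable.aemeasurable
  have := Measure.isProbabilityMeasure_map hY.aestronglyMeasurable.aemeasurable
  have hμ : MemLp id 2 (P.map X) :=
    (memLp_map_measure_iff aestronglyMeasurable_id hX.aestronglyMeasurable.aemeasurable).2 hX
  have hν : MemLp id 2 (P'.map Y) :=
    (memLp_map_measure_iff aestronglyMeasurable_id hY.aestronglyMeasurable.aemeasurable).2 hY
  generalize P.map X = μ at *
  generalize P'.map Y = ν at *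
  have := AffineTransport.isGaussian_normalApprox μ
  have := AffineTransport.isGaussian_normalApprox ν
  have hNμ : MemLp id 2 (AffineTransport.normalApprox μ) := IsGaussian.memLp_two_id
  have hNν : MemLp id 2 (AffineTransport.normalApprox ν) := IsGaussian.memLp_two_id
  have hup := AffineTransport.W2_le hμ hν
  have hlow := AffineTransport.le_W2 hμ hν
  have hNup := AffineTransport.W2_le hNμ hNν
  have hNlow := AffineTransport.le_W2 hNμ hNν
  -- Matching means and covariances turn the bounds for the Gaussian pair into those for `μ` and
  -- `ν`.
  simp only [AffineTransport.integral_normalApprox, AffineTransport.covMatrix_normalApprox hμ,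
    AffineTransport.covMatrix_normalApprox hν] at hNup hNlow
  have hA := AffineTransport.posSemidef_covMatrix hμ
  have hB := AffineTransport.posSemidef_covMatrix hν
  refine le_trans ?_ (AffineTransport.sqrt_add_sub_sqrt_le
    (sq_nonneg ‖∫ x, x ∂μ - ∫ x, x ∂ν‖) (add_nonneg hA.trace_nonneg hB.trace_nonneg)
    (AffineTransport.trace_principalSqrt_mul_nonneg hA hB)
    (AffineTransport.trace_principalSqrt_mul_eq_zero hA hB))
  rw [← add_assoc, abs_le]
  constructor <;> linarith
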